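/- Let $M,w\ge 1$ be integers, let $H\in\mathbb R^{M\times N}$ and $a\in\mathbb R^M$ be fixed, and let $\nu,\gamma,\tau,\epsilon>0$. Let $t_i,t_a,t_f$ be integers with $t_i\le t_a-w$ and $t_a\le t_f$. For $t_i\le t\le t_f$ consider measurements $$y^t = Hx^t-\theta^t a+e^t\in\mathbb R^M,\qquad \theta^t=0\ \text{for } t<t_a,\quad \theta^t=1\ \text{for } t\ge t_a,$$ where $a$ is the attack vector and $t_a$ the attack time; the states $x^t\in\mathbb R^N$ (deterministic, or random with any dependence on the noise) satisfy $\|x^t-x^{t_0}\|_2\le\gamma$ (almost surely) for all $t,t_0\in\{t_i,\dots,t_f\}$; and the entries of the noise vectors $e^t$, over all coordinates and all times $t_i\le t\le t_f$, are independent Gaussian variables with mean $0$ and variance $\nu^2$. Let $\Delta^{t_a}\in\mathbb R^{M\times w}$ be the history matrix with columns $y^{t_a}-y^{t_a-1},\dots,y^{t_a}-y^{t_a-w}$, let $\sigma_1$ denote the largest singular value and $\|H\|$ the operator norm of $H$ with respect to the Euclidean norms, and put $$\ell=\nu\sqrt w\sqrt M(1+\epsilon)+\nu(\sqrt M+\sqrt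 w+\tau)+\gamma\sqrt w\,\|H\|,\qquad u=\sqrt w\,\|a\|_2-\ell .$$ Then $$\mathbb P\big(\sigma_1(\Delta^{t_a})\le u\big)\le 2\exp\!\Big(-\frac{\tau^2}{2}\Big)+\big((1+\epsilon)e^{-\epsilon}\big)^{M/2},$$ and, if $a\neq 0$, the same bound holds conditionally on the event $\|a\|_2\ge\|e^{t_a}\|_2$: $$\mathbb P\big(\sigma_1(\Delta^{t_a})\le u\,\big|\,\|e^{t_a}\|_2\le\|a\|_2\big)\le 2\exp\!\Big(-\frac{\tau^2}{2}\Big)+\big((1+\epsilon)e^{-\epsilon}\big)^{M/2}.$$ -/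

import Mathlib

open MeasureTheory ProbabilityTheory

noncomputable section

/-- The attack indicator: `0` before the attack time `ta`, and `1` from `ta` on. -/
def attackIndicator (ta t : ℤ) : ℝ := if t < ta then 0 else 1

/-- The measurements under attack, `y^t = H x^t - θ^t a + e^t`, for a realization `x` of the states
and a realization `e` of the noise. -/
def measurement {M N : ℕ} (H : Matrix (Fin M) (Fin N) ℝ) (a : EuclideanSpace ℝ (Fin M)) (ta : ℤ)
    (x : ℤ → EuclideanSpace ℝ (Fin N)) (e : ℤ → EuclideanSpace ℝ (Fin M)) (t : ℤ) :
    EuclideanSpace ℝ (Fin M) :=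
  Matrix.toEuclideanLin H (x t) - attackIndicator ta t • a + e t

/-- The history matrix of window size `w` at time `t`: the `M × w` matrix with columns
`y^t - y^(t-1), …, y^t - y^(t-w)`. -/
def historyMatrix {M : ℕ} (w : ℕ) (y : ℤ → EuclideanSpace ℝ (Fin M)) (t : ℤ) :
    Matrix (Fin M) (Fin w) ℝ :=
  Matrix.of fun i j => y t i - y (t - ((j : ℕ) + 1 : ℤ)) i

/-- The largest singular value `σ₁` (Mathlib lists the singular values in decreasing order, starting
from the index `0`). -/
def sigmaOne {m n : ℕ} (B : Matrix (Fin m) (Fin n) ℝ) : ℝ :=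
  (Matrix.toEuclideanLin B).singularValues 0

/-- The operator norm of a matrix with respect to the Euclidean norms. -/
def matrixOpNorm {m n : ℕ} (B : Matrix (Fin m) (Fin n) ℝ) : ℝ :=
  ‖(Matrix.toEuclideanLin B).toContinuousLinearMap‖

/-- The threshold
`ℓ = ν √w √M (1 + ε) + ν (√M + √w + τ) + γ √w ‖H‖`. -/
def ellBound {M N : ℕ} (H : Matrix (Fin M) (Fin N) ℝ) (w : ℕ) (ν γ τ ε : ℝ) : ℝ :=
  ν * √w * √M * (1 + ε) + ν * (√M + √w + τ) + γ * √w * matrixOpNorm H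

/-- The threshold `u = √w ‖a‖ - ℓ`. -/
def uBound {M N : ℕ} (H : Matrix (Fin M) (Fin N) ℝ) (a : EuclideanSpace ℝ (Fin M))
    (w : ℕ) (ν γ τ ε : ℝ) : ℝ :=
  √w * ‖a‖ - ellBound H w ν γ τ ε

end

/-!
The largest singular value is bounded below by testing the history matrix on the all-ones vector
`𝟙`, of norm `√w`. In `Δ 𝟙` the attack adds up coherently: up to sign it contributes `w • a`, while
the states contribute at most `w γ ‖H‖`, the current noise contributes `w • e^{ta}`, and the past
noise contributes `S = ∑ⱼ e^{ta-j}`, whose entries are independent of law `N(0, w ν²)`. Hence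
(`norm_attack_le`)
`w ‖a‖ ≤ √w σ₁(Δ) + w ‖e^{ta}‖ + ‖S‖ + w γ ‖H‖`,
so `σ₁(Δ) ≤ u` forces `‖e^{ta}‖ ≥ ν √M (1 + ε)` or `‖S‖ ≥ √w ν (√M + τ)`
(`large_noise_of_sigmaOne_le`). No bound on the operator norm of a random matrix is needed; only a
single Gaussian vector `S` has to be controlled.

Both events have small probability by the Chernoff bound for a chi-square variable,
`ℙ(χ²_M ≥ M (1 + δ)) ≤ ((1 + δ) e^{-δ})^{M/2}` (`chernoff_sum_sq`). With `δ = ε` it handles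
`e^{ta}`; with `1 + δ = (1 + τ/√M)²` it gives `e^{-τ²/2}` for `S` (`gaussian_norm_tail`), which is
half of the exponential term allowed.

Conditioning on `‖e^{ta}‖ ≤ ‖a‖` does not increase either probability: `S` is independent of
`e^{ta}`, and an upper tail event of `‖e^{ta}‖` is negatively correlated with a lower tail event of
the same variable (`measureReal_cond_le`).
-/

/-! ### The largest singular value -/

/-- The zeroth singular value dominates the operator norm: expand `‖T v‖² = ⟪v, T* T v⟫` in an
orthonormal eigenbasis of `T* T`. -/
theorem LinearMap.norm_apply_le_singularValues_zero {E F : Type*}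
    [NormedAddCommGroup E] [InnerProductSpace ℝ E] [FiniteDimensional ℝ E]
    [NormedAddCommGroup F] [InnerProductSpace ℝ F] [FiniteDimensional ℝ F]
    (T : E →ₗ[ℝ] F) (v : E) : ‖T v‖ ≤ T.singularValues 0 * ‖v‖ := by
  refine le_of_sq_le_sq ?_ (mul_nonneg (T.singularValues_nonneg 0) (norm_nonneg v))
  set hT := T.isSymmetric_adjoint_comp_self
  set b := hT.eigenvectorBasis rfl
  have h1 : ‖T v‖ ^ 2 = ∑ i, hT.eigenvalues rfl i * inner ℝ (b i) v ^ 2 := by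
    rw [← real_inner_self_eq_norm_sq, ← LinearMap.adjoint_inner_right,
      ← b.sum_inner_mul_inner]
    refine Finset.sum_congr rfl fun i _ => ?_
    have := hT.eigenvectorBasis_apply_self_apply rfl v i
    simp only [OrthonormalBasis.repr_apply_apply, LinearMap.comp_apply] at this
    rw [this, real_inner_comm]
    simp only [RCLike.ofReal_real_eq_id, id_eq]
    ring
  rw [h1, mul_pow, ← b.sum_sq_inner_right v, Finset.mul_sum]
  refine Finset.sum_le_sum fun i _ => mul_le_mul_of_nonneg_right ?_ (sq_nonneg _)
  rw [← T.sq_singularValues_fin rfl i]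
  gcongr
  · exact T.singularValues_nonneg _
  · exact T.singularValues_antitone (Nat.zero_le _)

/-! ### Chernoff bounds for Gaussian vectors -/

open Real in
/-- The moment generating function of a squared centred Gaussian variable, below the critical value
`1 / (2 v)`. -/
theorem integral_exp_mul_sq_gaussianReal {v : NNReal} (hv : v ≠ 0) {t : ℝ} (ht : 2 * t * v < 1) :
    ∫ x, exp (t * x ^ 2) ∂(gaussianReal 0 v) = (√(1 - 2 * t * v))⁻¹ := by
  have hv0 : (0 : ℝ) < v := by positivity
  set b : ℝ := (1 - 2 * t * v) / (2 * v) with hb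
  have hpdf : ∀ x : ℝ, gaussianPDFReal 0 v x * exp (t * x ^ 2) =
      (√(2 * π * v))⁻¹ * exp (-b * x ^ 2) := by
    intro x
    rw [gaussianPDFReal, mul_assoc, ← Real.exp_add]
    congr 2
    rw [hb]; field_simp; ring
  rw [integral_gaussianReal_eq_integral_smul hv]
  simp only [smul_eq_mul, hpdf]
  rw [integral_const_mul, integral_gaussian, ← Real.sqrt_inv, ← Real.sqrt_inv, ← Real.sqrt_mul
    (by positivity)]
  congr 1
  have : 1 - 2 * t * v ≠ 0 := by linarith
  have := Real.pi_ne_zero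
  rw [hb]; field_simp

open Real in
/-- The Chernoff bound for the upper tail of a chi-square variable. -/
theorem chernoff_sum_sq {Ω : Type*} [MeasurableSpace Ω] {P : Measure Ω} [IsProbabilityMeasure P]
    {ι : Type*} [Fintype ι] {v : NNReal} (hv : v ≠ 0) {X : ι → Ω → ℝ}
    (hX : ∀ i, HasLaw (X i) (gaussianReal 0 v) P)
    (hindep : iIndepFun X P) {δ : ℝ} (hδ : 0 ≤ δ) :
    P.real {ω | v * Fintype.card ι * (1 + δ) ≤ ∑ i, X i ω ^ 2} ≤
      ((1 + δ) * exp (-δ)) ^ ((Fintype.card ι : ℝ) / 2) := by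
  have hv0 : (0 : ℝ) < v := by positivity
  -- the exponent that minimises the exponential bound
  set t : ℝ := δ / (2 * v * (1 + δ)) with ht
  have ht0 : 0 ≤ t := by positivity
  have h1 : 1 - 2 * t * v = (1 + δ)⁻¹ := by rw [ht]; field_simp; ring
  have h2 : 2 * t * v < 1 := by
    have : 0 < (1 + δ)⁻¹ := by positivity
    linarith
  have hmgf := integral_exp_mul_sq_gaussianReal hv h2
  have hY : ∀ i, mgf (fun ω => X i ω ^ 2) P t = √(1 + δ) := by
    intro i
    have := (hX i).integral_comp (f := fun x => exp (t * x ^ 2)) (by fun_prop)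
    rw [hmgf, h1, Real.sqrt_inv, inv_inv] at this
    exact this
  have hsum : mgf (∑ i, fun ω => X i ω ^ 2) P t = √(1 + δ) ^ Fintype.card ι := by
    have hind : iIndepFun (fun i ω => X i ω ^ 2) P :=
      hindep.comp (fun _ x => x ^ 2) (fun _ => by fun_prop)
    rw [hind.mgf_sum₀ (fun i => (hX i).aemeasurable.pow_const 2)]
    simp [hY]
  have hint : Integrable (fun ω => exp (t * (∑ i, fun ω => X i ω ^ 2) ω)) P := by
    -- were it not integrable, the moment generating function would have the junk value `0`
    by_contra h
    have : (0 : ℝ) < √(1 + δ) ^ Fintype.card ι := by positivity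
    rw [← hsum, mgf_undef h] at this
    exact this.false
  have hch := measure_ge_le_exp_mul_mgf (v * Fintype.card ι * (1 + δ)) ht0 hint
  simp only [Finset.sum_apply] at hch
  refine hch.trans_eq ?_
  rw [hsum, mul_rpow (by positivity) (exp_pos _).le, ← exp_mul, mul_comm, Real.sqrt_eq_rpow,
    ← Real.rpow_mul_natCast (by positivity)]
  congr 2
  · ring
  · rw [ht]; field_simp

theorem chernoff_norm {Ω : Type*} [MeasurableSpace Ω] {P : Measure Ω}
    [IsProbabilityMeasure P] {M : ℕ} {v : NNReal} (hv : v ≠ 0) {Z : Ω → EuclideanSpace ℝ (Fin M)}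
    (hZ : ∀ i, HasLaw (fun ω => Z ω i) (gaussianReal 0 v) P)
    (hindep : iIndepFun (fun i ω => Z ω i) P) {δ s : ℝ} (hδ : 0 ≤ δ) (hs : 0 ≤ s)
    (h : v * M * (1 + δ) ≤ s ^ 2) :
    P.real {ω | s ≤ ‖Z ω‖} ≤ ((1 + δ) * Real.exp (-δ)) ^ ((M : ℝ) / 2) := by
  refine le_trans (measureReal_mono fun ω (hω : s ≤ ‖Z ω‖) => ?_)
    ((chernoff_sum_sq hv hZ hindep hδ).trans_eq (by simp))
  rw [Set.mem_ofPred_eq, Fintype.card_fin, ← EuclideanSpace.real_norm_sq_eq]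
  exact h.trans (pow_le_pow_left₀ hs hω 2)

/-- The norm of a Gaussian vector exceeds `√v √M` by `√v τ` with probability at most `e^{-τ²/2}`.
With `η = τ / √M`, the chi-square bound at `1 + δ = (1 + η)²` is `((1 + η)² e^{-2η-η²})^{M/2}`, and
`(1 + η)² ≤ e^{2η}`. -/
theorem gaussian_norm_tail {Ω : Type*} [MeasurableSpace Ω] {P : Measure Ω}
    [IsProbabilityMeasure P] {M : ℕ} (hM : 0 < M) {v : NNReal} (hv : v ≠ 0)
    {Z : Ω → EuclideanSpace ℝ (Fin M)}
    (hZ : ∀ i, HasLaw (fun ω => Z ω i) (gaussianReal 0 v) P)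
    (hindep : iIndepFun (fun i ω => Z ω i) P) {τ : ℝ} (hτ : 0 ≤ τ) :
    P.real {ω | √v * (√M + τ) ≤ ‖Z ω‖} ≤ Real.exp (-(τ ^ 2 / 2)) := by
  have hM0 : (0 : ℝ) < M := by exact_mod_cast hM
  set η : ℝ := τ / √M with hη
  have hη0 : 0 ≤ η := by positivity
  have hηM : η ^ 2 * M = τ ^ 2 := by
    rw [hη, div_pow, Real.sq_sqrt hM0.le]; field_simp
  refine (chernoff_norm hv hZ hindep (δ := 2 * η + η ^ 2) (by positivity) (by positivity)
    (le_of_eq ?_)).trans ?_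
  · have : √M + τ = √M * (1 + η) := by rw [hη]; field_simp
    rw [this, mul_pow, mul_pow, Real.sq_sqrt hM0.le, Real.sq_sqrt v.coe_nonneg]
    ring
  · have hle : (1 + (2 * η + η ^ 2)) * Real.exp (-(2 * η + η ^ 2)) ≤ Real.exp (-η ^ 2) := by
      have h1 : (1 + η) ^ 2 ≤ Real.exp (2 * η) := by
        rw [two_mul, Real.exp_add, ← sq]
        exact pow_le_pow_left₀ (by positivity) (by linarith [Real.add_one_le_exp η]) 2
      calc _ = (1 + η) ^ 2 * Real.exp (-(2 * η + η ^ 2)) := by ring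
        _ ≤ Real.exp (2 * η) * Real.exp (-(2 * η + η ^ 2)) := by gcongr
        _ = _ := by rw [← Real.exp_add]; ring_nf
    refine (Real.rpow_le_rpow (by positivity) hle (by positivity)).trans_eq ?_
    rw [← Real.exp_mul, ← hηM]
    ring_nf

/-! ### Independence and sums of Gaussian variables -/

theorem indepFun_of_iIndepFun_of_disjoint_range {Ω : Type*} [MeasurableSpace Ω] {P : Measure Ω}
    {ι α β : Type*} [Fintype α] [Fintype β] {f : ι → Ω → ℝ} (hf : iIndepFun f P)
    (hm : ∀ i, AEMeasurable (f i) P) {p : α → ι} {q : β → ι} (hpq : ∀ a b, p a ≠ q b) :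
    IndepFun (fun ω a => f (p a) ω) (fun ω b => f (q b) ω) P := by
  classical
  have hd : Disjoint (Finset.univ.image p) (Finset.univ.image q) := by
    rw [Finset.disjoint_left]
    simp only [Finset.mem_image, Finset.mem_univ, true_and]
    rintro _ ⟨a, rfl⟩ ⟨b, hb⟩
    exact hpq a b hb.symm
  exact (hf.indepFun_finset₀ _ _ hd hm).comp
    (φ := fun z a => z ⟨p a, Finset.mem_image_of_mem p (Finset.mem_univ a)⟩)
    (ψ := fun z b => z ⟨q b, Finset.mem_image_of_mem q (Finset.mem_univ b)⟩)
    (by fun_prop) (by fun_prop)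

theorem hasLaw_sum_gaussianReal {Ω : Type*} [MeasurableSpace Ω] {P : Measure Ω}
    [IsProbabilityMeasure P] {κ : Type*} {v : NNReal} {f : κ → Ω → ℝ}
    (hf : ∀ k, HasLaw (f k) (gaussianReal 0 v) P) (hindep : iIndepFun f P) (s : Finset κ) :
    HasLaw (∑ k ∈ s, f k) (gaussianReal 0 (s.card * v)) P := by
  classical
  induction s using Finset.induction_on with
  | empty => 
    refine ⟨by rw [Finset.sum_empty]; exact aemeasurable_const, ?_⟩
    simp [Pi.zero_def, Measure.map_const]
  | insert k s hk ih =>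
    have hi := (hindep.indepFun_finsetSum_of_notMem₀ (fun k => (hf k).aemeasurable) hk).symm
    rw [Finset.sum_insert hk]
    refine ⟨(hf k).aemeasurable.add ih.aemeasurable, ?_⟩
    rw [gaussianReal_add_gaussianReal_of_indepFun hi (hf k).map_eq ih.map_eq,
      Finset.card_insert_of_notMem hk]
    congr 1
    · simp
    · push_cast; ring

/-- The column sums of an array of independent centred Gaussian variables are independent: they are
jointly Gaussian and uncorrelated. -/
theorem iIndepFun_sum_of_gaussian {Ω : Type*} [MeasurableSpace Ω] {P : Measure Ω}
    [IsProbabilityMeasure P] {κ ι : Type*} [Fintype κ] [Fintype ι] {v : NNReal}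
    {f : κ × ι → Ω → ℝ} (hf : ∀ p, HasLaw (f p) (gaussianReal 0 v) P) (hindep : iIndepFun f P) :
    iIndepFun (fun i ω => ∑ k, f (k, i) ω) P := by
  have hg : HasGaussianLaw (fun ω p => f p ω) P :=
    hindep.hasGaussianLaw fun p => (hf p).hasGaussianLaw
  have hL2 : ∀ p, MemLp (f p) 2 P := fun p => (hf p).hasGaussianLaw.memLp_two
  refine HasGaussianLaw.iIndepFun_of_covariance_eq_zero ?_ fun i j hij => ?_
  · exact hg.map (ContinuousLinearMap.pi fun i =>
      ∑ k, ContinuousLinearMap.proj (R := ℝ) (φ := fun _ : κ × ι => ℝ) (k, i)) |>.congr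
        (ae_of_all _ fun ω => by ext i; simp)
  · rw [covariance_fun_sum_fun_sum (fun k => hL2 (k, i)) (fun k => hL2 (k, j))]
    refine Finset.sum_eq_zero fun k _ => Finset.sum_eq_zero fun l _ => ?_
    exact (hindep.indepFun (by simp [hij])).covariance_eq_zero (hL2 _) (hL2 _)

/-- `gaussian_norm_tail` for a sum `S` of `w` independent Gaussian vectors, whose entries have
variance `w v`. -/
theorem gaussian_sum_norm_tail {Ω : Type*} [MeasurableSpace Ω] {P : Measure Ω}
    [IsProbabilityMeasure P] {M w : ℕ} (hM : 0 < M) (hw : 0 < w) {v : NNReal} (hv : v ≠ 0)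
    {f : Fin w × Fin M → Ω → ℝ} (hf : ∀ p, HasLaw (f p) (gaussianReal 0 v) P)
    (hindep : iIndepFun f P) {S : Ω → EuclideanSpace ℝ (Fin M)}
    (hS : ∀ i ω, S ω i = ∑ j, f (j, i) ω) {τ : ℝ} (hτ : 0 ≤ τ) :
    P.real {ω | √w * √v * (√M + τ) ≤ ‖S ω‖} ≤ Real.exp (-(τ ^ 2 / 2)) := by
  have hSlaw : ∀ i, HasLaw (fun ω => S ω i) (gaussianReal 0 (w * v)) P := fun i => by
    have h := hasLaw_sum_gaussianReal (f := fun j => f (j, i)) (fun j => hf (j, i))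
      (hindep.precomp (g := fun j => (j, i)) fun _ _ h => congrArg Prod.fst h) Finset.univ
    rw [Finset.card_univ, Fintype.card_fin] at h
    convert! h using 1
    ext ω; simp [hS]
  have hSind : iIndepFun (fun i ω => S ω i) P := by
    simp_rw [hS]
    exact iIndepFun_sum_of_gaussian hf hindep
  have h := gaussian_norm_tail hM (mul_ne_zero (Nat.cast_ne_zero.2 hw.ne') hv) hSlaw hSind hτ
  simpa using h

/-! ### Conditioning on a lower tail event -/

/-- If `S` is a.e. contained in the union of an upper tail event of `U` and one of `V`, where `U`
and `V` are independent, then the union bound for `S` survives conditioning on `V ≤ c`. The event on `U` is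
independent of the condition. For `V`, either `c < s` and the two events are disjoint, or they cover
the whole space and are therefore negatively correlated. If the condition has probability zero, the
conditional measure is zero. -/
theorem measureReal_cond_le {Ω : Type*} [MeasurableSpace Ω] {P : Measure Ω}
    [IsProbabilityMeasure P] {U V : Ω → ℝ} (hV : AEMeasurable V P)
    (hUV : IndepFun U V P) (r s c : ℝ) {S : Set Ω}
    (hS : ∀ᵐ ω ∂P, ω ∈ S → r ≤ U ω ∨ s ≤ V ω) :
    (cond P {ω | V ω ≤ c}).real S ≤ P.real {ω | r ≤ U ω} + P.real {ω | s ≤ V ω} := by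
  set C : Set Ω := V ⁻¹' Set.Iic c with hC
  change (cond P C).real S ≤ P.real (U ⁻¹' Set.Ici r) + P.real (V ⁻¹' Set.Ici s)
  have hCm : NullMeasurableSet C P := hV.nullMeasurable measurableSet_Iic
  have hcond : ∀ T, (cond P C).real T = (P.real C)⁻¹ * P.real (T ∩ C) := fun T => by
    simp [ProbabilityTheory.cond, measureReal_def, Measure.restrict_apply₀' hCm]
  have hmono : (cond P C).real S ≤
      (cond P C).real (U ⁻¹' Set.Ici r) + (cond P C).real (V ⁻¹' Set.Ici s) := by
    refine le_trans ?_ (measureReal_union_le _ _)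
    refine ENNReal.toReal_mono (measure_ne_top _ _) (measure_mono_ae ?_)
    exact cond_absolutelyContinuous.ae_le hS
  refine hmono.trans (add_le_add ?_ ?_)
  · rw [hcond, hC, measureReal_def P (_ ∩ _),
      hUV.measure_inter_preimage_eq_mul _ _ measurableSet_Ici measurableSet_Iic, ENNReal.toReal_mul,
      ← measureReal_def, ← measureReal_def, ← hC]
    rcases eq_or_ne (P.real C) 0 with h0 | h0
    · rw [h0]; simp
    · rw [mul_comm, mul_assoc, mul_inv_cancel₀ h0, mul_one]
  · rw [hcond]
    rcases eq_or_ne (P.real C) 0 with h0 | h0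
    · rw [h0]; simp
    have hpos : 0 < P.real C := lt_of_le_of_ne measureReal_nonneg (Ne.symm h0)
    rw [inv_mul_le_iff₀ hpos]
    rcases lt_or_ge c s with hcs | hcs
    · have : V ⁻¹' Set.Ici s ∩ C = ∅ := by
        ext ω
        simp only [hC, Set.mem_inter_iff, Set.mem_preimage, Set.mem_Ici, Set.mem_Iic,
          Set.mem_empty_iff_false, iff_false, not_and, not_le]
        exact fun h => hcs.trans_le h
      rw [this]; simp; positivity
    · have hun : V ⁻¹' Set.Ici s ∪ C = Set.univ := by
        ext ω
        simp only [hC, Set.mem_union, Set.mem_preimage, Set.mem_Ici, Set.mem_Iic, Set.mem_univ,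
          iff_true]
        exact (le_total s (V ω)).imp_right fun h => h.trans hcs
      have hadd := measureReal_union_add_inter₀ (μ := P) (s := V ⁻¹' Set.Ici s) (t := C) hCm
      rw [hun, probReal_univ] at hadd
      -- `p + q = 1 + P(both)` with `p, q ≤ 1` gives `P(both) ≤ p q`
      have h1 : P.real C ≤ 1 := measureReal_le_one
      have h2 : P.real (V ⁻¹' Set.Ici s) ≤ 1 := measureReal_le_one
      nlinarith

/-! ### The history matrix at the attack time -/

/-- The attack is visible in the history matrix tested on the all-ones vector, for each realization
of the noise and each realization of the states with increments bounded by `γ`. -/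
theorem norm_attack_le {M N w : ℕ} (H : Matrix (Fin M) (Fin N) ℝ)
    (a : EuclideanSpace ℝ (Fin M)) (ta : ℤ) {γ : ℝ}
    (x : ℤ → EuclideanSpace ℝ (Fin N)) (e : ℤ → EuclideanSpace ℝ (Fin M))
    (hx : ∀ j : Fin w, ‖x ta - x (ta - ((j : ℕ) + 1 : ℤ))‖ ≤ γ) :
    w * ‖a‖ ≤ √w * sigmaOne (historyMatrix w (measurement H a ta x e) ta) +
      w * ‖e ta‖ + ‖∑ j : Fin w, e (ta - ((j : ℕ) + 1 : ℤ))‖ + w * (γ * matrixOpNorm H) := by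
  set B := historyMatrix w (measurement H a ta x e) ta with hB
  set v : EuclideanSpace ℝ (Fin w) := WithLp.toLp 2 fun _ => 1 with hv
  have hvn : ‖v‖ = √w := by simp [hv, EuclideanSpace.norm_eq]
  have hσ : ‖Matrix.toEuclideanLin B v‖ ≤ √w * sigmaOne B := by
    rw [← hvn, mul_comm]
    exact LinearMap.norm_apply_le_singularValues_zero _ v
  have hBv : Matrix.toEuclideanLin B v =
      ∑ j : Fin w, (measurement H a ta x e ta -
        measurement H a ta x e (ta - ((j : ℕ) + 1 : ℤ))) := by
    ext i
    simp [hB, hv, historyMatrix, Matrix.toLpLin_apply, Matrix.mulVec, dotProduct]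
  have hcol : ∀ j : Fin w, measurement H a ta x e ta -
        measurement H a ta x e (ta - ((j : ℕ) + 1 : ℤ)) =
      Matrix.toEuclideanLin H (x ta - x (ta - ((j : ℕ) + 1 : ℤ))) - a + e ta -
        e (ta - ((j : ℕ) + 1 : ℤ)) := by
    intro j
    have h1 : attackIndicator ta ta = 1 := by simp [attackIndicator]
    have h2 : attackIndicator ta (ta - ((j : ℕ) + 1 : ℤ)) = 0 := by
      rw [attackIndicator, if_pos (by lia)]
    rw [measurement, measurement, h1, h2, map_sub, one_smul, zero_smul]
    abel
  have hkey : (w : ℝ) • a =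
      ∑ j : Fin w, Matrix.toEuclideanLin H (x ta - x (ta - ((j : ℕ) + 1 : ℤ))) + (w : ℝ) • e ta -
        ∑ j : Fin w, e (ta - ((j : ℕ) + 1 : ℤ)) - Matrix.toEuclideanLin B v := by
    rw [hBv, Finset.sum_congr rfl fun j _ => hcol j]
    simp only [Finset.sum_sub_distrib, Finset.sum_add_distrib, Finset.sum_const, Finset.card_univ,
      Fintype.card_fin, Nat.cast_smul_eq_nsmul]
    abel
  have hH : ‖∑ j : Fin w, Matrix.toEuclideanLin H (x ta - x (ta - ((j : ℕ) + 1 : ℤ)))‖ ≤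
      w * (γ * matrixOpNorm H) := by
    refine (norm_sum_le_of_le _ (f := fun j => Matrix.toEuclideanLin H _)
      (n := fun _ => γ * matrixOpNorm H) fun j _ => ?_).trans_eq (by simp)
    refine ((Matrix.toEuclideanLin H).toContinuousLinearMap.le_opNorm _).trans ?_
    rw [mul_comm]
    exact mul_le_mul_of_nonneg_right (hx j) (norm_nonneg _)
  have hw : ‖(w : ℝ) • a‖ = w * ‖a‖ := by simp [norm_smul]
  have hwe : ‖(w : ℝ) • e ta‖ = w * ‖e ta‖ := by simp [norm_smul]
  rw [← hw, hkey]
  refine (norm_sub_le _ _).trans ?_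
  grw [norm_sub_le, norm_add_le, hH, hσ, hwe]
  linarith

/-- If the largest singular value falls below the threshold, then the sum of the past noise vectors
or the current noise vector is large. -/
theorem large_noise_of_sigmaOne_le {M N w : ℕ} (hw : 0 < w) (H : Matrix (Fin M) (Fin N) ℝ)
    (a : EuclideanSpace ℝ (Fin M)) (ta : ℤ) {ν γ τ ε : ℝ} (hν : 0 ≤ ν)
    (x : ℤ → EuclideanSpace ℝ (Fin N)) (e : ℤ → EuclideanSpace ℝ (Fin M))
    (hx : ∀ j : Fin w, ‖x ta - x (ta - ((j : ℕ) + 1 : ℤ))‖ ≤ γ)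
    (hσ : sigmaOne (historyMatrix w (measurement H a ta x e) ta) ≤ uBound H a w ν γ τ ε) :
    √w * ν * (√M + τ) ≤ ‖∑ j : Fin w, e (ta - ((j : ℕ) + 1 : ℤ))‖ ∨
      ν * √M * (1 + ε) ≤ ‖e ta‖ := by
  have hw0 : (0 : ℝ) < w := by exact_mod_cast hw
  have hsq : √(w : ℝ) * √w = w := Real.mul_self_sqrt hw0.le
  have h := norm_attack_le H a ta x e hx
  have h2 := mul_le_mul_of_nonneg_left hσ (Real.sqrt_nonneg (w : ℝ))
  have h3 : √w * uBound H a w ν γ τ ε = w * ‖a‖ - (w * (ν * √M * (1 + ε)) +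
      √w * ν * (√M + τ) + w * ν + w * (γ * matrixOpNorm H)) := by
    rw [uBound, ellBound]
    linear_combination (‖a‖ - ν * √M * (1 + ε) - ν - γ * matrixOpNorm H) * hsq
  -- the summand `ν √w` of the threshold is not needed: it is discarded as `h5`
  by_contra! hcon
  have h4 := mul_lt_mul_of_pos_left hcon.2 hw0
  have h5 : 0 ≤ w * ν := by positivity
  linarith [hcon.1]

theorem theorem2
    {Ω : Type*} [MeasurableSpace Ω] (P : Measure Ω) [IsProbabilityMeasure P]
    {M N w : ℕ} (hM : 0 < M) (hw : 0 < w)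
    (H : Matrix (Fin M) (Fin N) ℝ) (a : EuclideanSpace ℝ (Fin M))
    (ti tf ta : ℤ) (hwindow : ti ≤ ta - w) (htf : ta ≤ tf)
    (ν γ τ ε : ℝ) (hν : 0 < ν) (hγ : 0 < γ) (hτ : 0 < τ) (hε : 0 < ε)
    -- the states: bounded variations over the time horizon
    (x : ℤ → Ω → EuclideanSpace ℝ (Fin N))
    (hx : ∀ᵐ ω ∂P, ∀ t ∈ Set.Icc ti tf, ∀ t₀ ∈ Set.Icc ti tf, ‖x t ω - x t₀ ω‖ ≤ γ)
    -- the noise: independent `N(0, ν²)` entries, independent over time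
    (e : ℤ → Ω → EuclideanSpace ℝ (Fin M))
    (he_law : ∀ t ∈ Set.Icc ti tf, ∀ i : Fin M,
      HasLaw (fun ω => e t ω i) (gaussianReal 0 ⟨ν ^ 2, sq_nonneg ν⟩) P)
    (he_indep : iIndepFun
      (fun (p : Set.Icc ti tf × Fin M) (ω : Ω) => e (p.1 : ℤ) ω p.2) P)
    -- the history matrix at the attack time
    (Δ : Ω → Matrix (Fin M) (Fin w) ℝ)
    (hΔ : ∀ ω, Δ ω =
      historyMatrix w (measurement H a ta (fun s => x s ω) (fun s => e s ω)) ta) :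
    -- the bound on the probability itself, with no restriction on the noise
    P.real {ω | sigmaOne (Δ ω) ≤ uBound H a w ν γ τ ε} ≤
        2 * Real.exp (-(τ ^ 2 / 2)) + ((1 + ε) * Real.exp (-ε)) ^ ((M : ℝ) / 2) ∧
    -- the same bound, conditionally on the event `‖e^{ta}‖ ≤ ‖a‖`
    (cond P {ω | ‖e ta ω‖ ≤ ‖a‖}).real {ω | sigmaOne (Δ ω) ≤ uBound H a w ν γ τ ε} ≤
        2 * Real.exp (-(τ ^ 2 / 2)) + ((1 + ε) * Real.exp (-ε)) ^ ((M : ℝ) / 2) := by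
  set v : NNReal := ⟨ν ^ 2, sq_nonneg ν⟩ with hv
  have hv0 : v ≠ 0 := by
    rw [← NNReal.coe_ne_zero]; exact (pow_pos hν 2).ne'
  have hvs : √(v : ℝ) = ν := Real.sqrt_sq hν.le
  have hta : ta ∈ Set.Icc ti tf := ⟨by lia, htf⟩
  have hpast : ∀ j : Fin w, ta - ((j : ℕ) + 1 : ℤ) ∈ Set.Icc ti tf := fun j =>
    ⟨by have := j.isLt; lia, by lia⟩
  have hlaw : ∀ p : Set.Icc ti tf × Fin M,
      HasLaw (fun ω => e (p.1 : ℤ) ω p.2) (gaussianReal 0 v) P := fun p => he_law _ p.1.2 p.2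
  set f : Fin w × Fin M → Ω → ℝ := fun p ω => e (ta - ((p.1 : ℕ) + 1 : ℤ)) ω p.2 with hf
  have hflaw : ∀ p, HasLaw (f p) (gaussianReal 0 v) P := fun p => hlaw (⟨_, hpast p.1⟩, p.2)
  have hfind : iIndepFun f P :=
    he_indep.precomp (g := fun p : Fin w × Fin M => (⟨_, hpast p.1⟩, p.2)) fun p q hpq => by
      simp only [Prod.mk.injEq, Subtype.mk.injEq] at hpq
      ext
      · lia
      · exact congrArg Fin.val hpq.2
  set S : Ω → EuclideanSpace ℝ (Fin M) := fun ω => ∑ j : Fin w, e (ta - ((j : ℕ) + 1 : ℤ)) ω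
    with hS
  have hSi : ∀ i ω, S ω i = ∑ j, f (j, i) ω := fun i ω => by simp [hS, hf]
  have hEind : iIndepFun (fun i ω => e ta ω i) P :=
    he_indep.precomp (g := fun i => (⟨ta, hta⟩, i)) fun _ _ h => congrArg Prod.snd h
  have hUV : IndepFun (fun ω => ‖S ω‖) (fun ω => ‖e ta ω‖) P := by
    have h := indepFun_of_iIndepFun_of_disjoint_range he_indep (fun p => (hlaw p).aemeasurable)
      (p := fun p : Fin w × Fin M => (⟨_, hpast p.1⟩, p.2)) (q := fun i => (⟨ta, hta⟩, i))
      (fun p i hpi => by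
        have : ta - ((p.1 : ℕ) + 1 : ℤ) = ta := congrArg (fun q => (q.1 : ℤ)) hpi
        lia)
    convert h.comp (φ := fun z => ‖WithLp.toLp 2 fun i => ∑ j, z (j, i)‖)
      (ψ := fun z => ‖WithLp.toLp 2 z‖) (by fun_prop) (by fun_prop) using 1
    · ext ω
      refine congrArg norm ?_
      ext i
      simp [hS]
    · rfl
  -- only the entries of `e ta` are known to be a.e. measurable
  have hVm : AEMeasurable (fun ω => ‖e ta ω‖) P := by
    have : AEMeasurable (fun ω i => e ta ω i) P :=
      aemeasurable_pi_lambda _ fun i => (he_law ta hta i).aemeasurable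
    exact (by fun_prop : Measurable fun z : Fin M → ℝ => ‖WithLp.toLp 2 z‖).comp_aemeasurable this
  have hpS : P.real {ω | √w * ν * (√M + τ) ≤ ‖S ω‖} ≤ Real.exp (-(τ ^ 2 / 2)) := by
    have h := gaussian_sum_norm_tail hM hw hv0 hflaw hfind hSi hτ.le
    rwa [hvs] at h
  -- the bound is applied at `1 + ε`, although the threshold would even allow `(1 + ε)²`
  have hpE : P.real {ω | ν * √M * (1 + ε) ≤ ‖e ta ω‖} ≤
      ((1 + ε) * Real.exp (-ε)) ^ ((M : ℝ) / 2) := by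
    refine chernoff_norm hv0 (he_law ta hta) hEind hε.le (by positivity) ?_
    rw [mul_pow, mul_pow, Real.sq_sqrt (Nat.cast_nonneg M)]
    refine mul_le_mul_of_nonneg_left ?_ (by positivity)
    nlinarith
  have hsub : ∀ᵐ ω ∂P, ω ∈ {ω | sigmaOne (Δ ω) ≤ uBound H a w ν γ τ ε} →
      √w * ν * (√M + τ) ≤ ‖S ω‖ ∨ ν * √M * (1 + ε) ≤ ‖e ta ω‖ := by
    filter_upwards [hx] with ω hω hmem
    rw [hΔ] at hmem
    exact large_noise_of_sigmaOne_le hw H a ta hν.le (fun s => x s ω) (fun s => e s ω)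
      (fun j => hω _ hta _ (hpast j)) hmem
  have hexp := (Real.exp_pos (-(τ ^ 2 / 2))).le
  constructor
  · have h1 : P.real {ω | sigmaOne (Δ ω) ≤ uBound H a w ν γ τ ε} ≤
        P.real ({ω | √w * ν * (√M + τ) ≤ ‖S ω‖} ∪ {ω | ν * √M * (1 + ε) ≤ ‖e ta ω‖}) :=
      ENNReal.toReal_mono (measure_ne_top _ _) (measure_mono_ae hsub)
    linarith [measureReal_union_le (μ := P) {ω | √w * ν * (√M + τ) ≤ ‖S ω‖}
      {ω | ν * √M * (1 + ε) ≤ ‖e ta ω‖}]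
  · linarith [measureReal_cond_le hVm hUV _ _ ‖a‖ hsub]
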